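/- Let $X,Z$ be complex Banach spaces and let $A$ be an injective sectorial operator of type $\omega$ on $X$, $0\le\omega<\pi/2$, not necessarily densely defined: $\sigma(A)\subseteq\overline{\Sigma_\omega}$ and $\sup_{\lambda\in\Sigma_{\pi-\nu}}\|\lambda(\lambda+A)^{-1}\|<\infty$ for every $\nu\in(\omega,\pi)$, where $\Sigma_\omega=\{re^{i\varphi}: r>0, |\varphi|<\omega\}$ for $\omega>0$ and $\Sigma_0=(0,\infty)$. Let $T(\cdot)$ be the bounded analytic semigroup generated by $-A$ (not necessarily strongly continuous at $0$; generation means $(\lambda+A)^{-1}x=\int_0^\infty e^{-\lambda t}T(t)x\,dt$ for $\lambda>0$, $x\in X$). Let $C: D(A)\to Z$ be linear and bounded for the norm $\|(I+A)\cdot\|_X$ on $D(A)$. Let $1\le p\le q\le\infty$ and $\alpha\in(-\tfrac1p,1-\tfrac1p)$. For $r\in[1,\infty]$ and $\beta\in\mathbb R$ let $L^r_\beta(Z)$ be the space of measurable $f:(0,\infty)\to Z$ with $\|f\|_{L^r_\beta(Z)}=\|t\mapsto t^\beta f(t)\|_{L^r((0,\infty),Z)}<\infty$, and let $\Psi_\infty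 x=C\,T(\cdot)x$ for $x\in X$. Let $L=A(I+A)^{-2}$, let $\mathbb X_{-1}$ be the Banach space containing $X$ for which $L$ extends to an isometric isomorphism $L_{-1}:\mathbb X_{-1}\to X$, and let $\mathbb A_{-1}=L_{-1}^{-1}AL_{-1}$, an injective operator in $\mathbb X_{-1}$ extending $A$. Put $\dot X_{-1}=\mathbb A_{-1}(X)$ and $\dot X_1=\mathbb A_{-1}^{-1}(X)$, with the norms $\|\mathbb A_{-1}^{-1}\cdot\|_X$ and $\|\mathbb A_{-1}\cdot\|_X$, and let $(\dot X_{-1},\dot X_1)_{1/2,p}$ be the real interpolation space of this couple of subspaces of $\mathbb X_{-1}$. Then: (a) If $\Psi_\infty$ is bounded $X\to L^p_\alpha(Z)$, then it is also bounded $X\to L^q_{\alpha+1/p-1/q}(Z)$. (b) If $\Psi_\infty$ is bounded $X\to L^q_{\alpha+1/p-1/q}(Z)$ and $X\hookrightarrow(\dot X_{-1},\dot X_1)_{1/2,p}$ (continuous embedding), then $\Psi_\infty$ is also bounded $X\to L^p_\alpha(Z)$. -/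

import Mathlib

open MeasureTheory Set
open scoped ENNReal NNReal

noncomputable section

namespace SectorialOp

/-! ### Sectors, resolvents and sectorial operators -/

/-- The open sector `Σ_ω = {r e^{iφ} : r > 0, |φ| < ω}` for `ω > 0`, and `Σ_0 = (0, ∞)`. -/
def sector (ω : ℝ) : Set ℂ :=
  if ω = 0 then {z | 0 < z.re ∧ z.im = 0} else {z | z ≠ 0 ∧ |z.arg| < ω}

variable {X : Type*} [NormedAddCommGroup X] [NormedSpace ℂ X]

/-- `R = (l + A)⁻¹`: the bounded operator `R` is a two-sided inverse of `l + A : D(A) → X`. -/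
structure IsShiftInverse (A : X →ₗ.[ℂ] X) (l : ℂ) (R : X →L[ℂ] X) : Prop where
  mem : ∀ x : X, R x ∈ A.domain
  right_inv : ∀ x : X, l • R x + A ⟨R x, mem x⟩ = x
  left_inv : ∀ x : A.domain, R (l • (x : X) + A x) = (x : X)

/-- The resolvent set `ϱ(A)`: all `μ` such that `μ - A` (equivalently `-μ + A`) has a bounded
everywhere defined inverse. -/
def resolventSet (A : X →ₗ.[ℂ] X) : Set ℂ :=
  {μ | ∃ R : X →L[ℂ] X, IsShiftInverse A (-μ) R}

/-- The spectrum `σ(A)`. -/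
def spectrum (A : X →ₗ.[ℂ] X) : Set ℂ := (resolventSet A)ᶜ

open Classical in
/-- The operator `(l + A)⁻¹` (with the value `0` if `-l` is not in the resolvent set). -/
def shiftInv (A : X →ₗ.[ℂ] X) (l : ℂ) : X →L[ℂ] X :=
  if h : ∃ R : X →L[ℂ] X, IsShiftInverse A l R then h.choose else 0

theorem IsShiftInverse.unique {A : X →ₗ.[ℂ] X} {l : ℂ} {R S : X →L[ℂ] X}
    (hR : IsShiftInverse A l R) (hS : IsShiftInverse A l S) : R = S := by
  ext x
  have h := hR.left_inv ⟨S x, hS.mem x⟩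
  rw [hS.right_inv x] at h
  exact h

theorem IsShiftInverse.shiftInv_eq {A : X →ₗ.[ℂ] X} {l : ℂ} {R : X →L[ℂ] X}
    (hR : IsShiftInverse A l R) : shiftInv A l = R := by
  have h : ∃ R : X →L[ℂ] X, IsShiftInverse A l R := ⟨R, hR⟩
  rw [shiftInv, dif_pos h]
  exact h.choose_spec.unique hR

/-- `A` is sectorial of type `ω`: its spectrum lies in the closure of `Σ_ω`, and for each
`ν ∈ (ω, π)` the operators `l (l + A)⁻¹`, `l ∈ Σ_{π - ν}`, are uniformly bounded.
The domain of `A` need not be dense. -/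
def IsSectorial (A : X →ₗ.[ℂ] X) (ω : ℝ) : Prop :=
  spectrum A ⊆ closure (sector ω) ∧
    ∀ ν ∈ Ioo ω Real.pi, ∃ M : ℝ, ∀ l ∈ sector (Real.pi - ν), ‖l • shiftInv A l‖ ≤ M

/-! ### Bounded analytic semigroups -/

/-- `T` is a bounded analytic semigroup: for some `δ ∈ (0, π/2]` it is holomorphic on `Σ_δ`, it
satisfies the semigroup law there, and it is bounded on each smaller sector.  No continuity at
`0` is required; the values of `T` off the sector play no role. -/
def IsBoundedAnalyticSemigroup (T : ℂ → X →L[ℂ] X) : Prop :=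
  ∃ δ ∈ Ioc 0 (Real.pi / 2),
    DifferentiableOn ℂ T (sector δ) ∧
    (∀ z ∈ sector δ, ∀ w ∈ sector δ, T (z + w) = T z ∘L T w) ∧
    ∀ δ' ∈ Ioo 0 δ, ∃ M : ℝ, ∀ z ∈ sector δ', ‖T z‖ ≤ M

/-- `-A` is the generator of the semigroup `T`, in the sense appropriate for semigroups that
need not be strongly continuous at `0`: the Laplace transform of `T` is the resolvent,
`(l + A)⁻¹ x = ∫₀^∞ e^{-l t} T(t) x dt` for `l > 0`.  This determines `T(t)`, `t > 0`. -/
def NegGenerates (A : X →ₗ.[ℂ] X) (T : ℂ → X →L[ℂ] X) : Prop :=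
  ∀ l : ℝ, 0 < l → ∃ R : X →L[ℂ] X, IsShiftInverse A (l : ℂ) R ∧
    ∀ x : X, R x = ∫ t in Ioi (0 : ℝ), Real.exp (-l * t) • T (t : ℂ) x

/-! ### Weighted Lebesgue spaces and the observation map -/

variable {Z : Type*} [NormedAddCommGroup Z] [NormedSpace ℂ Z]

open Classical in
/-- The function `t ↦ C T(t) x`.  For a bounded analytic semigroup generated by `-A` and `t > 0`,
`T(t) x` always lies in `D(A)`, so that the default value is not used. -/
def observation (A : X →ₗ.[ℂ] X) (T : ℂ → X →L[ℂ] X) (C : A.domain →ₗ[ℂ] Z) (x : X) (t : ℝ) : Z :=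
  if h : T (t : ℂ) x ∈ A.domain then C ⟨T (t : ℂ) x, h⟩ else 0

/-- The map `x ↦ C T(·) x` is bounded from `X` to `L^p_α((0, ∞), Z)`, the space of measurable `f`
with norm `‖t ↦ t^α f(t)‖_{L^p((0, ∞), Z)} < ∞`. -/
def IsBoundedObservation (A : X →ₗ.[ℂ] X) (T : ℂ → X →L[ℂ] X) (C : A.domain →ₗ[ℂ] Z)
    (p : ℝ≥0∞) (α : ℝ) : Prop :=
  ∃ M : ℝ≥0, ∀ x : X,
    MemLp (fun t : ℝ => t ^ α • observation A T C x t) p (volume.restrict (Ioi 0)) ∧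
    eLpNorm (fun t : ℝ => t ^ α • observation A T C x t) p (volume.restrict (Ioi 0)) ≤ M * ‖x‖ₑ

/-! ### The real interpolation method

A normed space continuously embedded in a vector space `E` is given by its norm, extended to
all of `E` by the value `∞` off the subspace. -/

/-- The `K`-functional `K(t, u) = inf {‖y‖₀ + t ‖z‖₁ : u = y + z}` of a couple. -/
def kFunctional {E : Type*} [AddCommGroup E] (N₀ N₁ : E → ℝ≥0∞) (t : ℝ) (u : E) : ℝ≥0∞ :=
  ⨅ (y : E) (z : E) (_ : y + z = u), N₀ y + ENNReal.ofReal t * N₁ z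

/-- The norm `‖t ↦ t^{-θ} K(t, u)‖_{L^p((0, ∞), dt/t)}` of the real interpolation space
`(E₀, E₁)_{θ, p}` (it is `∞` if `u` is not in that space). -/
def interpNorm {E : Type*} [AddCommGroup E] (N₀ N₁ : E → ℝ≥0∞) (θ : ℝ) (p : ℝ≥0∞) (u : E) :
    ℝ≥0∞ :=
  eLpNorm (fun t : ℝ => ENNReal.ofReal (t ^ (-θ)) * kFunctional N₀ N₁ t u) p
    ((volume.restrict (Ioi 0)).withDensity fun t => ENNReal.ofReal t⁻¹)

/-! ### Homogeneous inter- and extrapolation spaces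

Let `A` be injective and sectorial, and `L = A (1 + A)⁻²`, a bijection of `X` onto
`D(A) ∩ R(A)`.  The extrapolation space `𝕏₋₁` is a Banach space with an embedding
`ι : X → 𝕏₋₁` and an isometric isomorphism `L₋₁ : 𝕏₋₁ → X` such that `L₋₁ ∘ ι = L`.  These
properties determine it up to isometric isomorphism, and it is realized here as
`𝕏₋₁ = X`, `L₋₁ = id`, `ι = L`.  The extension `𝔸₋₁ = L₋₁⁻¹ A L₋₁` of `A` to `𝕏₋₁` is then `A`
itself, now acting on elements of `𝕏₋₁`. -/

/-- The operator `L = A (1 + A)⁻²`, written as `(1 + A)⁻¹ - (1 + A)⁻²`; it is also the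
embedding `ι : X → 𝕏₋₁`. -/
def extrapEmb (A : X →ₗ.[ℂ] X) : X →L[ℂ] X :=
  shiftInv A 1 - shiftInv A 1 ∘L shiftInv A 1

theorem extrapEmb_apply {A : X →ₗ.[ℂ] X} (h : IsShiftInverse A 1 (shiftInv A 1)) (x : X) :
    extrapEmb A x = A ⟨shiftInv A 1 (shiftInv A 1 x), h.mem _⟩ := by
  have h1 := h.right_inv (shiftInv A 1 x)
  rw [one_smul] at h1
  simp only [extrapEmb, _root_.sub_apply, ContinuousLinearMap.comp_apply]
  exact sub_eq_of_eq_add' h1.symm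

/-- The norm of `Ẋ₋₁ = 𝔸₋₁(X) ⊆ 𝕏₋₁`, `‖𝔸₋₁ ι x‖ = ‖x‖`, extended by `∞`. -/
def homNormNegOne (A : X →ₗ.[ℂ] X) (u : X) : ℝ≥0∞ :=
  ⨅ (x : X) (h : extrapEmb A x ∈ A.domain) (_ : A ⟨extrapEmb A x, h⟩ = u), ‖x‖ₑ

/-- The norm of `Ẋ₁ = 𝔸₋₁⁻¹(X) ⊆ 𝕏₋₁`, that is `‖u‖ = ‖x‖` if `𝔸₋₁ u = ι x`, extended by
`∞`. -/
def homNormOne (A : X →ₗ.[ℂ] X) (u : X) : ℝ≥0∞ :=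
  ⨅ (x : X) (h : u ∈ A.domain) (_ : A ⟨u, h⟩ = extrapEmb A x), ‖x‖ₑ

/-- The continuous embedding `X ↪ (Ẋ₋₁, Ẋ₁)_{θ, p}`. -/
def EmbedsInHomInterp (A : X →ₗ.[ℂ] X) (θ : ℝ) (p : ℝ≥0∞) : Prop :=
  ∃ c : ℝ≥0, ∀ x : X,
    interpNorm (homNormNegOne A) (homNormOne A) θ p (extrapEmb A x) ≤ c * ‖x‖ₑ

end SectorialOp

end

noncomputable section

open Filter Topology

namespace SectorialOp

variable {X : Type*} [NormedAddCommGroup X] [NormedSpace ℂ X]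
variable {Z : Type*} [NormedAddCommGroup Z] [NormedSpace ℂ Z]

/-! ### Bounded analytic semigroups on the positive half-line -/

/-! Put `a = α + 1/p`. The weighted norm of exponent `p` is then the `L^p(dt/t)` norm of `t ^ a • C
T(t) x`, and the one of exponent `q` has the same `a`. So both parts compare `L^p(dt/t)` with
`L^q(dt/t)` for a single function, and everything rests on the pointwise bound `‖C T(t)‖ ≤ K t ^
(-a)`.

The pointwise bound (`exists_norm_observeOp_le`) follows from the weighted bound for any exponent.
The vector `C T(s) (1/s + A)⁻¹ y` is an exponentially weighted average of `C T(v) y` over `v > s`,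
hence of size at most a constant times `s ^ (1 - a) ‖y‖`. For `y = (1/s + A) T(s) x`, whose norm is
at most a constant times `‖x‖ / s`, the vector is `C T(2s) x`. Part (a) then interpolates between
`L^p(dt/t)` and `L^∞`.

For (b), let `x = 𝔸 y + 𝔸⁻¹ z` in the extrapolation space. Then `A T(s) x = A² T(s) y + T(s) z`, so
`‖A T(s) x‖` is at most a constant times `s⁻² (‖y‖ + s² ‖z‖)`; optimizing over decompositions
produces the `K`-functional at `s²`. Together with the pointwise bound this controls the derivative
of `C T(t) x` by `t ^ (-a - 1)` times `t⁻¹ K(t², x)`. Since `C T(t) x` vanishes at infinity,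
integrating this derivative bound and applying Hardy's inequality bounds the weighted norm by the
interpolation norm with `θ = 1/2`. -/

/-- A semigroup `S` on `(0, ∞)` with derivative `D`, such that `S t` and `t D t` are bounded
by `M`. -/
structure IsSmoothSemigroup (S D : ℝ → X →L[ℂ] X) (M : ℝ) : Prop where
  bound_nonneg : 0 ≤ M
  add : ∀ t s : ℝ, 0 < t → 0 < s → S (t + s) = S t ∘L S s
  hasDerivAt : ∀ t : ℝ, 0 < t → HasDerivAt S (D t) t
  norm_le : ∀ t : ℝ, 0 < t → ‖S t‖ ≤ M
  norm_deriv_le : ∀ t : ℝ, 0 < t → ‖D t‖ ≤ M / t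

/-- A sector contains discs around the positive reals, of radius proportional to the centre. -/
theorem exists_closedBall_subset_sector {δ : ℝ} (hδ : 0 < δ) :
    ∃ ε : ℝ, 0 < ε ∧ ∀ t : ℝ, 0 < t → Metric.closedBall (t : ℂ) (t * ε) ⊆ sector δ := by
  have h1 : ∀ᶠ z in 𝓝 (1 : ℂ), z ≠ 0 ∧ |z.arg| < δ := by
    have hc : ContinuousAt (fun z : ℂ => |z.arg|) 1 :=
      (Complex.continuousAt_arg (by simp)).abs
    have h2 : ∀ᶠ z in 𝓝 (1 : ℂ), |z.arg| < δ := by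
      apply hc.eventually_lt continuousAt_const
      simpa using hδ
    exact (eventually_ne_nhds one_ne_zero).and h2
  obtain ⟨ε, hε, hb⟩ := Metric.nhds_basis_closedBall.eventually_iff.1 h1
  refine ⟨ε, hε, fun t ht z hz => ?_⟩
  have htc : (t : ℂ) ≠ 0 := by exact_mod_cast ht.ne'
  have hzt : z = t * (z / t) := by field_simp
  have hmem : z / t ∈ Metric.closedBall (1 : ℂ) ε := by
    rw [Metric.mem_closedBall, dist_eq_norm] at hz ⊢
    have : z / t - 1 = (z - t) / t := by field_simp
    rw [this, norm_div, Complex.norm_real, Real.norm_eq_abs, abs_of_pos ht,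
      div_le_iff₀ ht, mul_comm]
    exact hz
  obtain ⟨hne, harg⟩ := hb hmem
  rw [sector, if_neg hδ.ne']
  refine ⟨by rw [hzt]; exact mul_ne_zero htc hne, ?_⟩
  rw [hzt, Complex.arg_real_mul _ ht]
  exact harg

theorem ofReal_mem_sector {δ : ℝ} (hδ : 0 < δ) {t : ℝ} (ht : 0 < t) : (t : ℂ) ∈ sector δ := by
  rw [sector, if_neg hδ.ne']
  refine ⟨by exact_mod_cast ht.ne', ?_⟩
  rw [Complex.arg_ofReal_of_nonneg ht.le, abs_zero]
  exact hδ

theorem sector_mono {δ δ' : ℝ} (h0 : 0 < δ') (h : δ' ≤ δ) : sector δ' ⊆ sector δ := by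
  rw [sector, sector, if_neg h0.ne', if_neg (h0.trans_le h).ne']
  exact fun z hz => ⟨hz.1, hz.2.trans_le h⟩

/-- Cauchy's estimate on discs of radius proportional to `t` bounds `t T'(t)`. This is the only use
of analyticity; from here on only the positive half-line matters. -/
theorem IsBoundedAnalyticSemigroup.exists_isSmoothSemigroup {T : ℂ → X →L[ℂ] X}
    (hT : IsBoundedAnalyticSemigroup T) :
    ∃ M : ℝ, IsSmoothSemigroup (fun t : ℝ => T t) (fun t : ℝ => deriv T t) M := by
  obtain ⟨δ, hδ, hd, hadd, hbd⟩ := hT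
  obtain ⟨M, hM⟩ := hbd (δ / 2) ⟨by linarith [hδ.1], by linarith [hδ.1]⟩
  have hδ2 : 0 < δ / 2 := by linarith [hδ.1]
  have hsub : sector (δ / 2) ⊆ sector δ := sector_mono hδ2 (by linarith)
  obtain ⟨ε, hε, hball⟩ := exists_closedBall_subset_sector hδ2
  have hM0 : 0 ≤ M := (norm_nonneg _).trans (hM _ (ofReal_mem_sector hδ2 one_pos))
  -- One constant serves both bounds: `M` for the operators, `M * ε⁻¹` for `t` times the
  -- derivatives.
  have hM' : M ≤ M * (1 + ε⁻¹) := by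
    have := inv_pos.2 hε
    nlinarith
  refine ⟨M * (1 + ε⁻¹), by positivity, fun t s ht hs => ?_, fun t ht => ?_,
    fun t ht => (hM _ (ofReal_mem_sector hδ2 ht)).trans hM', fun t ht => ?_⟩
  · simpa using hadd t (ofReal_mem_sector hδ.1 ht) s (ofReal_mem_sector hδ.1 hs)
  · have hn : sector δ ∈ 𝓝 (t : ℂ) :=
      mem_of_superset (Metric.closedBall_mem_nhds _ (mul_pos ht hε)) ((hball t ht).trans hsub)
    have h1 := (hd.differentiableAt hn).hasDerivAt
    have h2 := h1.scomp t (Complex.ofRealCLM.hasDerivAt (x := t))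
    simp only [Complex.ofRealCLM_apply, Complex.ofReal_one, one_smul] at h2
    exact h2
  · have h1 : ‖deriv T t‖ ≤ M / (t * ε) := by
      apply Complex.norm_deriv_le_of_forall_mem_sphere_norm_le (mul_pos ht hε)
      · apply DifferentiableOn.diffContOnCl
        exact hd.mono ((Metric.closure_ball_subset_closedBall.trans (hball t ht)).trans hsub)
      · exact fun z hz => hM z (hball t ht (Metric.sphere_subset_closedBall hz))
    refine h1.trans ?_
    rw [← div_div, div_right_comm, div_le_div_iff_of_pos_right ht, div_eq_mul_inv]
    exact mul_le_mul_of_nonneg_left (by linarith) hM0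

namespace IsSmoothSemigroup

variable {S D : ℝ → X →L[ℂ] X} {M : ℝ}

theorem comm (h : IsSmoothSemigroup S D M) {t s : ℝ} (ht : 0 < t) (hs : 0 < s) :
    S t ∘L S s = S s ∘L S t := by
  rw [← h.add t s ht hs, ← h.add s t hs ht, add_comm]

theorem hasDerivAt_apply (h : IsSmoothSemigroup S D M) {t : ℝ} (ht : 0 < t) (x : X) :
    HasDerivAt (fun u => S u x) (D t x) t := by
  have := ((ContinuousLinearMap.apply ℂ X x).restrictScalars ℝ).hasFDerivAt.comp_hasDerivAt t
    (h.hasDerivAt t ht)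
  exact this

theorem deriv_add (h : IsSmoothSemigroup S D M) {t s : ℝ} (ht : 0 < t) (hs : 0 < s) :
    D (t + s) = S t ∘L D s := by
  ext x
  have h1 : HasDerivAt (fun u => S (t + u) x) (D (t + s) x) s :=
    (h.hasDerivAt_apply (add_pos ht hs) x).comp_const_add t s
  have h2 : HasDerivAt (fun u => S t (S u x)) (S t (D s x)) s :=
    ((S t).restrictScalars ℝ).hasFDerivAt.comp_hasDerivAt s (h.hasDerivAt_apply hs x)
  refine h1.unique (h2.congr_of_eventuallyEq ?_)
  filter_upwards [lt_mem_nhds hs] with u hu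
  rw [h.add t u ht hu]
  rfl

theorem deriv_add' (h : IsSmoothSemigroup S D M) {t s : ℝ} (ht : 0 < t) (hs : 0 < s) :
    D (t + s) = D t ∘L S s := by
  ext x
  have h1 : HasDerivAt (fun u => S (u + s) x) (D (t + s) x) t :=
    (h.hasDerivAt_apply (add_pos ht hs) x).comp_add_const t s
  have h2 : HasDerivAt (fun u => S u (S s x)) (D t (S s x)) t := h.hasDerivAt_apply ht _
  refine h1.unique (h2.congr_of_eventuallyEq ?_)
  filter_upwards [lt_mem_nhds ht] with u hu
  rw [h.add u s hu hs]
  rfl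

theorem continuousOn (h : IsSmoothSemigroup S D M) (x : X) :
    ContinuousOn (fun t => S t x) (Ioi 0) :=
  fun _ ht => (h.hasDerivAt_apply ht x).continuousAt.continuousWithinAt

theorem integrableOn (h : IsSmoothSemigroup S D M) {l : ℝ} (hl : 0 < l) (x : X) :
    IntegrableOn (fun t => Real.exp (-l * t) • S t x) (Ioi 0) := by
  have h1 : IntegrableOn (fun t => Real.exp (-l * t) * (M * ‖x‖)) (Ioi 0) :=
    (integrableOn_exp_mul_Ioi (by linarith) 0).mul_const _
  refine h1.mono' ?_ ?_
  · refine ContinuousOn.aestronglyMeasurable ?_ measurableSet_Ioi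
    have hc : Continuous fun t : ℝ => Real.exp (-l * t) := by fun_prop
    exact hc.continuousOn.smul (h.continuousOn x)
  · filter_upwards [ae_restrict_mem measurableSet_Ioi] with t ht
    rw [norm_smul, Real.norm_of_nonneg (Real.exp_nonneg _)]
    gcongr
    exact (S t).le_of_opNorm_le (h.norm_le t ht) x

section Laplace

variable [CompleteSpace X] {l : ℝ} {R : X →L[ℂ] X}

theorem laplace_comm (h : IsSmoothSemigroup S D M) (hl : 0 < l)
    (hR : ∀ x, R x = ∫ t in Ioi (0 : ℝ), Real.exp (-l * t) • S t x) {s : ℝ} (hs : 0 < s) (x : X) :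
    S s (R x) = R (S s x) := by
  rw [hR, hR, ← (S s).integral_comp_comm (h.integrableOn hl x)]
  refine setIntegral_congr_fun measurableSet_Ioi fun t ht => ?_
  have := DFunLike.congr_fun (h.comm hs ht) x
  simp only [ContinuousLinearMap.comp_apply] at this
  simp only [← this]
  exact ((S s).restrictScalars ℝ).map_smul _ _

theorem laplace_deriv_comm (h : IsSmoothSemigroup S D M) (hl : 0 < l)
    (hR : ∀ x, R x = ∫ t in Ioi (0 : ℝ), Real.exp (-l * t) • S t x) {s : ℝ} (hs : 0 < s) (x : X) :
    D s (R x) = R (D s x) := by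
  have h1 := h.hasDerivAt_apply hs (R x)
  have h2 := (R.restrictScalars ℝ).hasFDerivAt.comp_hasDerivAt s (h.hasDerivAt_apply hs x)
  refine h1.unique (h2.congr_of_eventuallyEq ?_)
  filter_upwards [lt_mem_nhds hs] with u hu
  exact h.laplace_comm hl hR hu x

/-- Formally `(l + A)⁻¹ (l + A) S s = S s` with `D = -A S`. It is the fundamental theorem of
calculus for `u ↦ exp (-l u) S (u + s) x`; the shift by `s > 0` keeps this function differentiable
at `u = 0`, where `S` itself need not be continuous. -/
theorem laplace_regularize (h : IsSmoothSemigroup S D M) (hl : 0 < l)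
    (hR : ∀ x, R x = ∫ t in Ioi (0 : ℝ), Real.exp (-l * t) • S t x) {s : ℝ} (hs : 0 < s) (x : X) :
    R (l • S s x - D s x) = S s x := by
  have hder : ∀ u : ℝ, 0 ≤ u → HasDerivAt (fun u => Real.exp (-l * u) • S (u + s) x)
      (Real.exp (-l * u) • D (u + s) x + (Real.exp (-l * u) * (-l)) • S (u + s) x) u := by
    intro u hu
    have h1 : HasDerivAt (fun u : ℝ => Real.exp (-l * u)) (Real.exp (-l * u) * (-l)) u := by
      simpa using ((hasDerivAt_id u).const_mul (-l)).exp
    exact h1.smul ((h.hasDerivAt_apply (by linarith) x).comp_add_const u s)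
  have hint := (h.integrableOn hl (l • S s x - D s x)).neg
  have heq : ∀ u ∈ Ioi (0 : ℝ), -(Real.exp (-l * u) • S u (l • S s x - D s x)) =
      Real.exp (-l * u) • D (u + s) x + (Real.exp (-l * u) * (-l)) • S (u + s) x := by
    intro u hu
    rw [h.deriv_add hu hs, h.add u s hu hs]
    have : S u (l • S s x) = l • S u (S s x) := ((S u).restrictScalars ℝ).map_smul _ _
    rw [map_sub, this]
    simp only [ContinuousLinearMap.comp_apply]
    module
  have hlim : Tendsto (fun u => Real.exp (-l * u) • S (u + s) x) atTop (𝓝 0) := by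
    apply squeeze_zero_norm' (a := fun u => Real.exp (-l * u) * (M * ‖x‖))
    · filter_upwards [eventually_gt_atTop 0] with u hu
      rw [norm_smul, Real.norm_of_nonneg (Real.exp_nonneg _)]
      gcongr
      exact (S (u + s)).le_of_opNorm_le (h.norm_le _ (by linarith)) x
    · rw [← zero_mul (M * ‖x‖)]
      refine Tendsto.mul_const _ (Real.tendsto_exp_atBot.comp ?_)
      exact tendsto_id.const_mul_atTop_of_neg (by linarith)
  have key := integral_Ioi_of_hasDerivAt_of_tendsto (hder 0 le_rfl).continuousAt.continuousWithinAt
    (fun u hu => hder u (le_of_lt hu))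
    (IntegrableOn.congr_fun hint heq measurableSet_Ioi) hlim
  rw [← setIntegral_congr_fun measurableSet_Ioi heq, integral_neg, ← hR] at key
  simp only [mul_zero, Real.exp_zero, one_smul, zero_add, zero_sub, neg_inj] at key
  exact key

end Laplace

end IsSmoothSemigroup

/-! ### The generator and the semigroup -/

theorem IsShiftInverse.injective {A : X →ₗ.[ℂ] X} {l : ℂ} {R : X →L[ℂ] X}
    (hAR : IsShiftInverse A l R) :
    Function.Injective R := by
  rw [injective_iff_map_eq_zero]
  intro x hx
  have h1 := hAR.right_inv x
  have h2 : (⟨R x, hAR.mem x⟩ : A.domain) = 0 := Subtype.ext hx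
  rw [h2, hx, smul_zero, zero_add, A.map_zero] at h1
  exact h1.symm

theorem extrapEmb_injective {A : X →ₗ.[ℂ] X}
    (hinj : Function.Injective (fun x : A.domain => A x))
    (hAR : IsShiftInverse A 1 (shiftInv A 1)) : Function.Injective (extrapEmb A) := by
  rw [injective_iff_map_eq_zero]
  intro x hx
  rw [extrapEmb_apply hAR, ← A.map_zero] at hx
  have h1 := congrArg Subtype.val (hinj hx)
  exact hAR.injective (hAR.injective (by simpa using h1))

section Generator

variable [CompleteSpace X] {A : X →ₗ.[ℂ] X} {S D : ℝ → X →L[ℂ] X} {M l : ℝ} {R : X →L[ℂ] X}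

theorem IsSmoothSemigroup.mem_domain (h : IsSmoothSemigroup S D M) (hl : 0 < l)
    (hR : ∀ x, R x = ∫ t in Ioi (0 : ℝ), Real.exp (-l * t) • S t x)
    (hAR : IsShiftInverse A (l : ℂ) R) {t : ℝ} (ht : 0 < t) (x : X) : S t x ∈ A.domain := by
  rw [← h.laplace_regularize hl hR ht x]
  exact hAR.mem _

/-- Write `w = R y` with `y = (l + A) w` and move `R` through the semigroup in `laplace_regularize`.
-/
theorem IsSmoothSemigroup.apply_generator (h : IsSmoothSemigroup S D M) (hl : 0 < l)
    (hR : ∀ x, R x = ∫ t in Ioi (0 : ℝ), Real.exp (-l * t) • S t x)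
    (hAR : IsShiftInverse A (l : ℂ) R) {t : ℝ} (ht : 0 < t) (w : A.domain) :
    S t (A w) = -D t w := by
  have hw := hAR.left_inv w
  set y := (l : ℂ) • (w : X) + A w with hy
  have hAw : A w = y - (l : ℂ) • (w : X) := by rw [hy]; abel
  have h1 := h.laplace_regularize hl hR ht y
  rw [← Complex.coe_smul, map_sub, map_smul, ← h.laplace_comm hl hR ht,
    ← h.laplace_deriv_comm hl hR ht, hw] at h1
  rw [hAw, map_sub, map_smul, ← h1]
  abel

/-- The derivative of the semigroup along a decomposition `x = 𝔸 y + 𝔸⁻¹ z` in the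
extrapolation space. -/
theorem IsSmoothSemigroup.deriv_decomposition (h : IsSmoothSemigroup S D M)
    (hinj : Function.Injective (fun x : A.domain => A x))
    (hR : ∀ x, shiftInv A 1 x = ∫ t in Ioi (0 : ℝ), Real.exp (-1 * t) • S t x)
    (hAR : IsShiftInverse A 1 (shiftInv A 1)) {x y z u v : X}
    (hy : extrapEmb A y ∈ A.domain) (hu : A ⟨extrapEmb A y, hy⟩ = u)
    (hv : v ∈ A.domain) (hz : A ⟨v, hv⟩ = extrapEmb A z) (huv : u + v = extrapEmb A x)
    {s : ℝ} (hs : 0 < s) :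
    -D s x = D (s / 2) (D (s / 2) y) + S s z := by
  have hAR' : IsShiftInverse A ((1 : ℝ) : ℂ) (shiftInv A 1) := by simpa using hAR
  have hs2 : 0 < s / 2 := by linarith
  have hS : ∀ w, extrapEmb A (S s w) = S s (extrapEmb A w) := by
    intro w
    simp only [extrapEmb, _root_.sub_apply, ContinuousLinearMap.comp_apply, map_sub,
      h.laplace_comm one_pos hR hs]
  have hD : ∀ t, 0 < t → ∀ w, extrapEmb A (D t w) = D t (extrapEmb A w) := by
    intro t ht w
    simp only [extrapEmb, _root_.sub_apply, ContinuousLinearMap.comp_apply, map_sub,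
      h.laplace_deriv_comm one_pos hR ht]
  -- The identity is checked after applying the embedding into the extrapolation space, where the
  -- decomposition `u + v` lives; the embedding commutes with `S` and `D`.
  apply extrapEmb_injective hinj hAR
  rw [map_neg, map_add, hS, hD _ hs, hD _ hs2, hD _ hs2, ← huv, map_add, ← hz,
    h.apply_generator one_pos hR hAR' hs, ← hu, neg_add]
  congr 1
  -- Splitting `D s = D (s/2) S (s/2)` lets the second factor absorb the `A` in `u`, so the
  -- second-order term becomes a product of two first derivatives.
  have h1 := h.deriv_add' hs2 hs2
  rw [add_halves] at h1
  rw [h1, ContinuousLinearMap.comp_apply, h.apply_generator one_pos hR hAR' hs2, map_neg, neg_neg]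

end Generator

/-! ### The observation operators -/

section Observation

variable {S D : ℝ → X →L[ℂ] X} {M : ℝ}

/-- The bounded operator `C (1 + A)⁻¹`. -/
def observeResolvent {A : X →ₗ.[ℂ] X} {R : X →L[ℂ] X} (hAR : IsShiftInverse A 1 R)
    (C : A.domain →ₗ[ℂ] Z) (K : ℝ) (hC : ∀ x : A.domain, ‖C x‖ ≤ K * ‖(x : X) + A x‖) :
    X →L[ℂ] Z :=
  LinearMap.mkContinuous (C ∘ₗ R.toLinearMap.codRestrict A.domain hAR.mem) K fun x => by
    have h1 := hC ⟨R x, hAR.mem x⟩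
    have h2 := hAR.right_inv x
    rw [one_smul] at h2
    rw [h2] at h1
    exact h1

/-- The operators `B (1 + A) S t`. -/
def observeOp (B : X →L[ℂ] Z) (S D : ℝ → X →L[ℂ] X) (t : ℝ) : X →L[ℂ] Z :=
  B ∘L (S t - D t)

theorem IsSmoothSemigroup.observeOp_add (h : IsSmoothSemigroup S D M) (B : X →L[ℂ] Z)
    {t s : ℝ} (ht : 0 < t) (hs : 0 < s) (x : X) :
    observeOp B S D (t + s) x = observeOp B S D t (S s x) := by
  simp only [observeOp, h.add t s ht hs, h.deriv_add' ht hs, ContinuousLinearMap.comp_apply,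
    _root_.sub_apply]

/-- Near `t`, the factor `C S (t/2)` is frozen and only `S (u - t/2)` is differentiated. No second
derivative of `S` appears, and the result is ready for the pointwise bound. -/
theorem IsSmoothSemigroup.hasDerivAt_observeOp (h : IsSmoothSemigroup S D M) (B : X →L[ℂ] Z)
    {t : ℝ} (ht : 0 < t) (x : X) :
    HasDerivAt (fun u => observeOp B S D u x) (observeOp B S D (t / 2) (D (t / 2) x)) t := by
  have h0 : HasDerivAt (fun v => S v x) (D (t / 2) x) (t - t / 2) := by
    have := h.hasDerivAt_apply (show 0 < t / 2 by linarith) x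
    rwa [show t - t / 2 = t / 2 by ring]
  have h1 : HasDerivAt (fun u => S (u - t / 2) x) (D (t / 2) x) t := h0.comp_sub_const t (t / 2)
  have h2 := ((observeOp B S D (t / 2)).restrictScalars ℝ).hasFDerivAt.comp_hasDerivAt t h1
  refine h2.congr_of_eventuallyEq ?_
  filter_upwards [lt_mem_nhds (show t / 2 < t by linarith)] with u hu
  have := h.observeOp_add B (t := t / 2) (s := u - t / 2) (by linarith) (by linarith) x
  rw [add_sub_cancel] at this
  exact this

theorem IsSmoothSemigroup.continuousOn_observeOp (h : IsSmoothSemigroup S D M) (B : X →L[ℂ] Z)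
    (x : X) : ContinuousOn (fun t => observeOp B S D t x) (Ioi 0) :=
  fun _ ht => (h.hasDerivAt_observeOp B ht x).continuousAt.continuousWithinAt

theorem IsSmoothSemigroup.observation_eq [CompleteSpace X] {A : X →ₗ.[ℂ] X} {T : ℂ → X →L[ℂ] X}
    {D : ℝ → X →L[ℂ] X} (h : IsSmoothSemigroup (fun t : ℝ => T t) D M) {R : X →L[ℂ] X}
    (hR : ∀ x, R x = ∫ t in Ioi (0 : ℝ), Real.exp (-1 * t) • T t x)
    (hAR : IsShiftInverse A 1 R)
    (C : A.domain →ₗ[ℂ] Z) (K : ℝ) (hC : ∀ x : A.domain, ‖C x‖ ≤ K * ‖(x : X) + A x‖)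
    (x : X) {t : ℝ} (ht : 0 < t) :
    observation A T C x t = observeOp (observeResolvent hAR C K hC) (fun t : ℝ => T t) D t x := by
  have hAR' : IsShiftInverse A ((1 : ℝ) : ℂ) R := by simpa using hAR
  have h1 := h.laplace_regularize one_pos hR ht x
  rw [one_smul] at h1
  rw [observation, dif_pos (h.mem_domain one_pos hR hAR' ht x)]
  refine congrArg C (Subtype.ext ?_)
  exact h1.symm

end Observation

/-! ### Weighted norms in scale-invariant form -/

theorem enorm_rpow_smul {t : ℝ} (ht : 0 < t) (b : ℝ) (z : Z) :
    ‖t ^ b • z‖ₑ = ENNReal.ofReal (t ^ b) * ‖z‖ₑ := by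
  rw [enorm_smul, Real.enorm_of_nonneg (Real.rpow_nonneg ht.le _)]

theorem ofReal_rpow_sub_inv_mul_rpow {t P : ℝ} (ht : 0 < t) (hP : 0 < P) (a : ℝ) (g : ℝ≥0∞) :
    (ENNReal.ofReal (t ^ (a - P⁻¹)) * g) ^ P
      = ENNReal.ofReal t⁻¹ * (ENNReal.ofReal (t ^ a) * g) ^ P := by
  rw [ENNReal.mul_rpow_of_nonneg _ _ hP.le, ENNReal.mul_rpow_of_nonneg _ _ hP.le, ← mul_assoc,
    ENNReal.ofReal_rpow_of_pos (Real.rpow_pos_of_pos ht _),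
    ENNReal.ofReal_rpow_of_pos (Real.rpow_pos_of_pos ht _),
    ← ENNReal.ofReal_mul (inv_nonneg.2 ht.le), ← Real.rpow_mul ht.le, ← Real.rpow_mul ht.le,
    sub_mul, inv_mul_cancel₀ hP.ne', Real.rpow_sub_one ht.ne', div_eq_inv_mul]

/-- The shift of the exponent by `1/p` turns `dt` into the scale-invariant `dt/t`, leaving the
weight `t ^ a` independent of `p`. -/
theorem eLpNorm_rpow_smul {p : ℝ≥0∞} (hp0 : p ≠ 0) (hp : p ≠ ∞) (a : ℝ) (f : ℝ → Z) :
    eLpNorm (fun t : ℝ => t ^ (a - (p⁻¹).toReal) • f t) p (volume.restrict (Ioi 0)) =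
      (∫⁻ t in Ioi (0 : ℝ), ENNReal.ofReal t⁻¹ *
        (ENNReal.ofReal (t ^ a) * ‖f t‖ₑ) ^ p.toReal) ^ (1 / p.toReal) := by
  rw [eLpNorm_eq_lintegral_rpow_enorm_toReal hp0 hp]
  congr 1
  refine setLIntegral_congr_fun measurableSet_Ioi fun t ht => ?_
  simp only [enorm_rpow_smul ht, ENNReal.toReal_inv]
  exact ofReal_rpow_sub_inv_mul_rpow ht (ENNReal.toReal_pos hp0 hp) a _

theorem eLpNorm_rpow_smul_le_iff {p : ℝ≥0∞} (hp0 : p ≠ 0) (hp : p ≠ ∞) (a : ℝ) (f : ℝ → Z)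
    (N : ℝ≥0∞) :
    eLpNorm (fun t : ℝ => t ^ (a - (p⁻¹).toReal) • f t) p (volume.restrict (Ioi 0)) ≤ N ↔
      ∫⁻ t in Ioi (0 : ℝ), ENNReal.ofReal t⁻¹ *
        (ENNReal.ofReal (t ^ a) * ‖f t‖ₑ) ^ p.toReal ≤ N ^ p.toReal := by
  rw [eLpNorm_rpow_smul hp0 hp, one_div, ENNReal.rpow_inv_le_iff (ENNReal.toReal_pos hp0 hp)]

/-! ### Pointwise bounds -/

/-- Where `g ≥ r`, one has `1 ≤ r ^ (1 - P) * g ^ (P - 1)`. Cutting at level `r` replaces Hölder's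
inequality and avoids conjugate exponents. -/
theorem le_add_rpow_mul_rpow {P : ℝ} (hP : 1 ≤ P) {r g : ℝ≥0∞} (hr : r ≠ 0) (hr' : r ≠ ∞) :
    g ≤ r + r ^ (1 - P) * g ^ P := by
  rcases le_total g r with h | h
  · exact h.trans le_self_add
  · refine le_trans ?_ le_add_self
    have hPsub : 0 ≤ P - 1 := by linarith
    calc g = 1 * g := (one_mul g).symm
      _ ≤ (r ^ (1 - P) * g ^ (P - 1)) * g := by
        gcongr
        rw [show (1 : ℝ) - P = -(P - 1) by ring, ENNReal.rpow_neg]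
        calc (1 : ℝ≥0∞) = (r ^ (P - 1))⁻¹ * r ^ (P - 1) :=
            (ENNReal.inv_mul_cancel (by simp [ENNReal.rpow_eq_zero_iff, hr, hr'])
              (by simp [ENNReal.rpow_eq_top_iff, hr, hr'])).symm
          _ ≤ _ := by gcongr
      _ = r ^ (1 - P) * g ^ P := by
        rw [mul_assoc]
        congr 1
        conv_lhs => rw [← ENNReal.rpow_one g, ← ENNReal.rpow_mul, one_mul]
        rw [← ENNReal.rpow_add_of_nonneg _ _ hPsub zero_le_one, sub_add_cancel]

/-- With `v / s ≥ 1` and `1 - a ≤ 1`, the power `(v / s) ^ (1 - a)` is at most `v / s = 1 + (v - s)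
/ s`, which the exponential dominates. -/
theorem exp_mul_rpow_le {a s v : ℝ} (ha : 0 < a) (hs : 0 < s) (hv : s < v) :
    Real.exp (-(v - s) / s) * v ^ (1 - a) ≤ s ^ (1 - a) := by
  have h1 : 1 ≤ v / s := by rw [one_le_div hs]; exact hv.le
  have h2 : (v / s) ^ (1 - a) ≤ Real.exp ((v - s) / s) := by
    calc (v / s) ^ (1 - a) ≤ (v / s) ^ (1 : ℝ) :=
          Real.rpow_le_rpow_of_exponent_le h1 (by linarith)
      _ = (v - s) / s + 1 := by rw [Real.rpow_one]; field_simp; ring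
      _ ≤ _ := Real.add_one_le_exp _
  rw [Real.div_rpow (hs.trans hv).le hs.le, div_le_iff₀ (Real.rpow_pos_of_pos hs _)] at h2
  rw [neg_div, Real.exp_neg, inv_mul_le_iff₀ (Real.exp_pos _)]
  exact h2

theorem lintegral_exp_neg_sub_div {s : ℝ} (hs : 0 < s) :
    ∫⁻ v in Ioi s, ENNReal.ofReal (Real.exp (-(v - s) / s)) = ENNReal.ofReal s := by
  have hneg : -(1 / s) < 0 := by have := one_div_pos.2 hs; linarith
  have heq : ∀ v : ℝ, Real.exp (-(v - s) / s) = Real.exp 1 * Real.exp (-(1 / s) * v) := by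
    intro v
    rw [← Real.exp_add]
    congr 1
    field_simp
    ring
  simp only [heq]
  rw [← ofReal_integral_eq_lintegral_ofReal
    ((integrableOn_exp_mul_Ioi hneg s).const_mul _) (ae_of_all _ fun v => by positivity),
    integral_const_mul, integral_exp_mul_Ioi hneg]
  congr 1
  rw [show -(1 / s) * s = -1 by field_simp, Real.exp_neg]
  field_simp

/-- The bounded part uses `v ^ (-a) ≤ s ^ (-a)` and the mass `s` of the kernel; the part integrable
for `dv/v` uses the supremum `s ^ (1 - a)` of the kernel relative to `dv/v`. Each contributes `s ^
(1 - a) N`. -/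
theorem lintegral_exp_mul_enorm_le {Z : Type*} [NormedAddCommGroup Z] {a s : ℝ} (ha : 0 < a)
    (hs : 0 < s) {f : ℝ → Z}
    {h : ℝ → ℝ≥0∞} {N : ℝ≥0∞}
    (hfh : ∀ᵐ v ∂volume.restrict (Ioi (0 : ℝ)), ENNReal.ofReal (v ^ a) * ‖f v‖ₑ ≤ N + h v)
    (hh : ∫⁻ v in Ioi (0 : ℝ), ENNReal.ofReal v⁻¹ * h v ≤ N) :
    ∫⁻ v in Ioi s, ENNReal.ofReal (Real.exp (-(v - s) / s)) * ‖f v‖ₑ ≤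
      2 * (ENNReal.ofReal (s ^ (1 - a)) * N) := by
  have hsub : Ioi s ⊆ Ioi (0 : ℝ) := Ioi_subset_Ioi hs.le
  calc ∫⁻ v in Ioi s, ENNReal.ofReal (Real.exp (-(v - s) / s)) * ‖f v‖ₑ
      ≤ ∫⁻ v in Ioi s, (ENNReal.ofReal (Real.exp (-(v - s) / s)) * (ENNReal.ofReal (s ^ (-a)) * N)
          + ENNReal.ofReal (s ^ (1 - a)) * (ENNReal.ofReal v⁻¹ * h v)) := by
        refine lintegral_mono_ae ?_
        filter_upwards [ae_restrict_of_ae_restrict_of_subset hsub hfh,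
          ae_restrict_mem measurableSet_Ioi] with v hv (hsv : s < v)
        have hv0 : 0 < v := hs.trans hsv
        have h1 : ‖f v‖ₑ = ENNReal.ofReal (v ^ (-a)) * (ENNReal.ofReal (v ^ a) * ‖f v‖ₑ) := by
          rw [← mul_assoc, ← ENNReal.ofReal_mul (Real.rpow_nonneg hv0.le _),
            ← Real.rpow_add hv0, neg_add_cancel, Real.rpow_zero, ENNReal.ofReal_one, one_mul]
        calc ENNReal.ofReal (Real.exp (-(v - s) / s)) * ‖f v‖ₑ
            ≤ ENNReal.ofReal (Real.exp (-(v - s) / s)) *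
                (ENNReal.ofReal (v ^ (-a)) * (N + h v)) := by
              rw [h1]
              gcongr
          _ = ENNReal.ofReal (Real.exp (-(v - s) / s)) * (ENNReal.ofReal (v ^ (-a)) * N) +
                ENNReal.ofReal (Real.exp (-(v - s) / s) * v ^ (1 - a)) *
                  (ENNReal.ofReal v⁻¹ * h v) := by
              rw [show v ^ (1 - a) = v ^ (-a) / v⁻¹ by
                  rw [div_inv_eq_mul, ← Real.rpow_add_one hv0.ne']; congr 1; ring,
                ← mul_assoc (ENNReal.ofReal (_ * _)), ← ENNReal.ofReal_mul (by positivity),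
                mul_assoc (Real.exp _), div_mul_cancel₀ _ (inv_ne_zero hv0.ne'),
                ENNReal.ofReal_mul (Real.exp_nonneg _)]
              ring
          _ ≤ _ := by
              have h2 := ENNReal.ofReal_le_ofReal
                (Real.rpow_le_rpow_of_nonpos hs hsv.le (neg_nonpos.2 ha.le))
              have h3 := ENNReal.ofReal_le_ofReal (exp_mul_rpow_le ha hs hsv)
              exact add_le_add (mul_le_mul_right (mul_le_mul_left h2 N) _) (mul_le_mul_left h3 _)
    _ = ENNReal.ofReal s * (ENNReal.ofReal (s ^ (-a)) * N) +
          ENNReal.ofReal (s ^ (1 - a)) * ∫⁻ v in Ioi s, ENNReal.ofReal v⁻¹ * h v := by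
        have hm : Measurable fun v : ℝ => ENNReal.ofReal (Real.exp (-(v - s) / s)) := by fun_prop
        rw [lintegral_add_left (hm.mul_const _), lintegral_mul_const _ hm,
          lintegral_exp_neg_sub_div hs, lintegral_const_mul' _ _ ENNReal.ofReal_ne_top]
    _ ≤ ENNReal.ofReal (s ^ (1 - a)) * N + ENNReal.ofReal (s ^ (1 - a)) * N := by
        refine add_le_add (le_of_eq ?_) (mul_le_mul_right ((lintegral_mono_set hsub).trans hh) _)
        rw [← mul_assoc, ← ENNReal.ofReal_mul hs.le, mul_comm s, ← Real.rpow_add_one hs.ne']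
        congr 3
        ring
    _ = _ := (two_mul _).symm

/-- A bound on a weighted `L^p` norm splits the function into a bounded and an integrable part. -/
theorem exists_majorant {p : ℝ≥0∞} (hp : 1 ≤ p) {a : ℝ} {f : ℝ → Z} {N : ℝ≥0} {r : ℝ≥0∞}
    (hr : r ≠ 0) (hr' : r ≠ ∞)
    (hf : eLpNorm (fun t : ℝ => t ^ (a - (p⁻¹).toReal) • f t) p (volume.restrict (Ioi 0))
      ≤ N * r) :
    ∃ h : ℝ → ℝ≥0∞,
      (∀ᵐ v ∂volume.restrict (Ioi (0 : ℝ)), ENNReal.ofReal (v ^ a) * ‖f v‖ₑ ≤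
        (1 + N + N ^ p.toReal : ℝ≥0) * r + h v) ∧
      ∫⁻ v in Ioi (0 : ℝ), ENNReal.ofReal v⁻¹ * h v ≤ (1 + N + N ^ p.toReal : ℝ≥0) * r := by
  rcases eq_or_ne p ∞ with rfl | hpt
  · refine ⟨0, ?_, by simp⟩
    simp only [ENNReal.inv_top, ENNReal.toReal_zero, sub_zero, eLpNorm_exponent_top] at hf
    filter_upwards [enorm_ae_le_eLpNormEssSup (fun t : ℝ => t ^ a • f t)
      (volume.restrict (Ioi 0)), ae_restrict_mem measurableSet_Ioi] with v hv hv0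
    rw [enorm_rpow_smul hv0] at hv
    refine (hv.trans hf).trans (le_add_right (mul_le_mul_left ?_ r))
    rw [ENNReal.coe_le_coe]
    exact le_add_right le_add_self
  · have hP : 1 ≤ p.toReal := by
      rw [← ENNReal.toReal_one]
      exact ENNReal.toReal_mono hpt hp
    have hP0 : 0 < p.toReal := by linarith
    have hp0 : p ≠ 0 := (zero_lt_one.trans_le hp).ne'
    rw [eLpNorm_rpow_smul_le_iff hp0 hpt] at hf
    -- Cutting at level `r` makes both parts scale linearly in `r`: the integral is at most `r ^ (1
    -- - p) (N r) ^ p = N ^ p r`.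
    refine ⟨fun v => r ^ (1 - p.toReal) * (ENNReal.ofReal (v ^ a) * ‖f v‖ₑ) ^ p.toReal,
      ae_of_all _ fun v => ?_, ?_⟩
    · refine (le_add_rpow_mul_rpow hP hr hr').trans ?_
      gcongr
      refine le_mul_of_one_le_left' ?_
      rw [ENNReal.one_le_coe_iff, add_assoc]
      exact le_self_add
    · have hrP : r ^ (1 - p.toReal) ≠ ∞ := by simp [ENNReal.rpow_eq_top_iff, hr, hr']
      calc ∫⁻ v in Ioi (0 : ℝ), ENNReal.ofReal v⁻¹ *
            (r ^ (1 - p.toReal) * (ENNReal.ofReal (v ^ a) * ‖f v‖ₑ) ^ p.toReal)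
          = r ^ (1 - p.toReal) * ∫⁻ v in Ioi (0 : ℝ), ENNReal.ofReal v⁻¹ *
            (ENNReal.ofReal (v ^ a) * ‖f v‖ₑ) ^ p.toReal := by
            rw [← lintegral_const_mul' _ _ hrP]
            exact lintegral_congr fun v => mul_left_comm _ _ _
        _ ≤ r ^ (1 - p.toReal) * (N * r) ^ p.toReal := by gcongr
        _ = N ^ p.toReal * r := by
            rw [ENNReal.mul_rpow_of_nonneg _ _ hP0.le, mul_left_comm, ← ENNReal.rpow_add _ _ hr hr',
              sub_add_cancel, ENNReal.rpow_one]
        _ ≤ _ := by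
            rw [← ENNReal.coe_rpow_of_nonneg _ hP0.le]
            gcongr
            exact le_add_self

theorem lintegral_Ioi_add_left (s : ℝ) (F : ℝ → ℝ≥0∞) :
    ∫⁻ u in Ioi (0 : ℝ), F (s + u) = ∫⁻ v in Ioi s, F v := by
  have := (measurePreserving_add_left volume s).setLIntegral_comp_preimage_emb
    (MeasurableEquiv.addLeft s).measurableEmbedding F (Ioi s)
  rw [← this]
  congr 2
  ext u
  simp

section PointwiseBound

variable [CompleteSpace X] [CompleteSpace Z] {S D : ℝ → X →L[ℂ] X} {M : ℝ}

/-- Move `C S s` inside the Laplace integral at `l = 1/s` and substitute `v = s + u`: the orbit of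
`y` is integrated over `v > s` against `exp (-(v - s) / s)`. -/
theorem IsSmoothSemigroup.enorm_observeOp_laplace_le (h : IsSmoothSemigroup S D M)
    (B : X →L[ℂ] Z) {p : ℝ≥0∞} (hp : 1 ≤ p) {a : ℝ} (ha : 0 < a) {N : ℝ≥0}
    (hB : ∀ x, eLpNorm (fun t : ℝ => t ^ (a - (p⁻¹).toReal) • observeOp B S D t x) p
      (volume.restrict (Ioi 0)) ≤ N * ‖x‖ₑ) {s : ℝ} (hs : 0 < s) {R : X →L[ℂ] X}
    (hR : ∀ x, R x = ∫ t in Ioi (0 : ℝ), Real.exp (-(1 / s) * t) • S t x) (y : X) :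
    ‖observeOp B S D s (R y)‖ₑ ≤
      2 * (ENNReal.ofReal (s ^ (1 - a)) * ((1 + N + N ^ p.toReal : ℝ≥0) * ‖y‖ₑ)) := by
  -- The cutting level in `exists_majorant` is `‖y‖ₑ`, which must not vanish.
  rcases eq_or_ne y 0 with rfl | hy
  · simp
  obtain ⟨g, hg, hg'⟩ := exists_majorant hp (enorm_ne_zero.2 hy) enorm_ne_top (hB y)
  refine le_trans ?_ (lintegral_exp_mul_enorm_le ha hs hg hg')
  rw [hR, ← (observeOp B S D s).integral_comp_comm (h.integrableOn (one_div_pos.2 hs) y),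
    ← lintegral_Ioi_add_left]
  refine (enorm_integral_le_lintegral_enorm _).trans (le_of_eq ?_)
  refine setLIntegral_congr_fun measurableSet_Ioi fun u hu => ?_
  have h1 : observeOp B S D s (Real.exp (-(1 / s) * u) • S u y) =
      Real.exp (-(1 / s) * u) • observeOp B S D (s + u) y := by
    rw [h.observeOp_add B hs hu]
    exact ((observeOp B S D s).restrictScalars ℝ).map_smul _ _
  simp only [h1]
  rw [enorm_smul, Real.enorm_of_nonneg (Real.exp_nonneg _)]
  rw [show -(1 / s) * u = -(s + u - s) / s by ring]

/-- A weighted `L^p` bound on the orbits gives a pointwise bound on the observation operators. -/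
theorem IsSmoothSemigroup.exists_norm_observeOp_le (h : IsSmoothSemigroup S D M)
    (B : X →L[ℂ] Z) {p : ℝ≥0∞} (hp : 1 ≤ p) {a : ℝ} (ha : 0 < a) {N : ℝ≥0}
    (hB : ∀ x, eLpNorm (fun t : ℝ => t ^ (a - (p⁻¹).toReal) • observeOp B S D t x) p
      (volume.restrict (Ioi 0)) ≤ N * ‖x‖ₑ)
    (hR : ∀ l : ℝ, 0 < l → ∃ R : X →L[ℂ] X,
      ∀ x, R x = ∫ t in Ioi (0 : ℝ), Real.exp (-l * t) • S t x) :
    ∃ K : ℝ, 0 ≤ K ∧ ∀ t : ℝ, 0 < t → ∀ x, ‖observeOp B S D t x‖ ≤ K * t ^ (-a) * ‖x‖ := by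
  set c : ℝ≥0 := 1 + N + N ^ p.toReal with hc
  have hM := h.bound_nonneg
  refine ⟨4 * c * M * 2 ^ a, by positivity, fun t ht x => ?_⟩
  set s := t / 2 with hs_def
  have hs : 0 < s := half_pos ht
  obtain ⟨R, hR⟩ := hR (1 / s) (one_div_pos.2 hs)
  -- This is `(1/s + A) S s x`, so that `R y = S s x` and `C S s (R y) = C S (2s) x`.
  set y := (1 / s) • S s x - D s x with hy
  have h1 : observeOp B S D t x = observeOp B S D s (R y) := by
    rw [hy, h.laplace_regularize (one_div_pos.2 hs) hR hs, ← h.observeOp_add B hs hs, hs_def,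
      add_halves]
  have hyn : ‖y‖ ≤ 2 * M / s * ‖x‖ := by
    calc ‖y‖ ≤ ‖(1 / s) • S s x‖ + ‖D s x‖ := norm_sub_le _ _
      _ ≤ 1 / s * (M * ‖x‖) + M / s * ‖x‖ := by
        rw [norm_smul, Real.norm_of_nonneg (one_div_pos.2 hs).le]
        gcongr
        · exact (S s).le_of_opNorm_le (h.norm_le s hs) x
        · exact (D s).le_of_opNorm_le (h.norm_deriv_le s hs) x
      _ = _ := by ring
  have h2 : ‖observeOp B S D s (R y)‖ ≤ 2 * (s ^ (1 - a) * (c * ‖y‖)) := by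
    have h3 := h.enorm_observeOp_laplace_le B hp ha hB hs hR y
    rw [← hc, ← ofReal_norm, ← ofReal_norm, ← ENNReal.ofReal_coe_nnreal,
      ← ENNReal.ofReal_mul (by positivity), ← ENNReal.ofReal_mul (by positivity),
      ← ENNReal.ofReal_ofNat 2, ← ENNReal.ofReal_mul (by positivity),
      ENNReal.ofReal_le_ofReal_iff (by positivity)] at h3
    exact h3
  rw [h1]
  refine h2.trans ?_
  calc 2 * (s ^ (1 - a) * (c * ‖y‖)) ≤ 2 * (s ^ (1 - a) * (c * (2 * M / s * ‖x‖))) := by gcongr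
    _ = 4 * c * M * s ^ (-a) * ‖x‖ := by
      rw [show 1 - a = -a + 1 by ring, Real.rpow_add_one hs.ne']
      field_simp
      ring
    _ = _ := by
      rw [hs_def, Real.div_rpow ht.le zero_le_two, Real.rpow_neg zero_le_two, div_inv_eq_mul]
      ring

end PointwiseBound

/-! ### Interpolation between weighted norms -/

/-- For finite `q`, factor `g ^ q = g ^ (q - p) * g ^ p` and bound the first factor by `N ^ (q -
p)`; this works because both norms use the same measure `dt/t`. -/
theorem eLpNorm_rpow_smul_le_of_le {p q : ℝ≥0∞} (hp : 1 ≤ p) (hpq : p ≤ q) {a : ℝ} {f : ℝ → Z}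
    {N : ℝ≥0∞} (hN : N ≠ ∞)
    (hf : ∀ t : ℝ, 0 < t → ENNReal.ofReal (t ^ a) * ‖f t‖ₑ ≤ N)
    (hfp : eLpNorm (fun t : ℝ => t ^ (a - (p⁻¹).toReal) • f t) p (volume.restrict (Ioi 0)) ≤ N) :
    eLpNorm (fun t : ℝ => t ^ (a - (q⁻¹).toReal) • f t) q (volume.restrict (Ioi 0)) ≤ N := by
  rcases eq_or_ne q ∞ with rfl | hq
  · simp only [ENNReal.inv_top, ENNReal.toReal_zero, sub_zero, eLpNorm_exponent_top]
    refine eLpNormEssSup_le_of_ae_enorm_bound ?_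
    filter_upwards [ae_restrict_mem measurableSet_Ioi] with t ht
    rw [enorm_rpow_smul ht]
    exact hf t ht
  · have hpt : p ≠ ∞ := ne_top_of_le_ne_top hq hpq
    have hp0 : p ≠ 0 := (zero_lt_one.trans_le hp).ne'
    have hq0 : q ≠ 0 := (zero_lt_one.trans_le (hp.trans hpq)).ne'
    have hP : 0 < p.toReal := ENNReal.toReal_pos hp0 hpt
    have hPQ : p.toReal ≤ q.toReal := ENNReal.toReal_mono hq hpq
    have hsplit : ∀ g : ℝ≥0∞, g ^ q.toReal = g ^ (q.toReal - p.toReal) * g ^ p.toReal := fun g => by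
      rw [← ENNReal.rpow_add_of_nonneg _ _ (sub_nonneg.2 hPQ) hP.le, sub_add_cancel]
    rw [eLpNorm_rpow_smul_le_iff hp0 hpt] at hfp
    rw [eLpNorm_rpow_smul_le_iff hq0 hq]
    calc ∫⁻ t in Ioi (0 : ℝ), ENNReal.ofReal t⁻¹ * (ENNReal.ofReal (t ^ a) * ‖f t‖ₑ) ^ q.toReal
        ≤ ∫⁻ t in Ioi (0 : ℝ), N ^ (q.toReal - p.toReal) *
            (ENNReal.ofReal t⁻¹ * (ENNReal.ofReal (t ^ a) * ‖f t‖ₑ) ^ p.toReal) := by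
          refine setLIntegral_mono' measurableSet_Ioi fun t ht => ?_
          rw [hsplit, mul_left_comm]
          exact mul_le_mul_left (ENNReal.rpow_le_rpow (hf t ht) (sub_nonneg.2 hPQ)) _
      _ ≤ N ^ (q.toReal - p.toReal) * N ^ p.toReal := by
          rw [lintegral_const_mul' _ _ (ENNReal.rpow_ne_top_of_nonneg (sub_nonneg.2 hPQ) hN)]
          gcongr
      _ = _ := (hsplit N).symm

/-! ### Hardy's inequality -/

theorem lintegral_Ioi_rpow_neg {a t : ℝ} (ha : 0 < a) (ht : 0 < t) :
    ∫⁻ s in Ioi t, ENNReal.ofReal (s ^ (-a - 1)) = ENNReal.ofReal (t ^ (-a) / a) := by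
  rw [← ofReal_integral_eq_lintegral_ofReal (integrableOn_Ioi_rpow_of_lt (by linarith) ht),
    integral_Ioi_rpow_of_lt (by linarith) ht]
  · rw [sub_add_cancel, neg_div_neg_eq]
  · filter_upwards [ae_restrict_mem measurableSet_Ioi] with s hs
    exact Real.rpow_nonneg (ht.trans hs).le _

theorem lintegral_Ioo_rpow {a s : ℝ} (ha : 0 < a) (hs : 0 < s) :
    ∫⁻ t in Ioo 0 s, ENNReal.ofReal (t ^ (a - 1)) = ENNReal.ofReal (s ^ a / a) := by
  have hi := (intervalIntegral.intervalIntegrable_rpow' (a := 0) (b := s)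
    (show -1 < a - 1 by linarith))
  rw [setLIntegral_congr Ioo_ae_eq_Ioc, ← ofReal_integral_eq_lintegral_ofReal,
    ← intervalIntegral.integral_of_le hs.le, integral_rpow (Or.inl (by linarith))]
  · rw [sub_add_cancel, Real.zero_rpow ha.ne', sub_zero]
  · exact (intervalIntegrable_iff_integrableOn_Ioc_of_le hs.le).1 hi
  · filter_upwards [ae_restrict_mem measurableSet_Ioc] with t ht
    exact Real.rpow_nonneg ht.1.le _

/-- The comparison of the `L^1` and `L^P` norms for the measure with density `w`, whose total mass
supplies the first factor. -/
theorem rpow_lintegral_mul_le {P : ℝ} (hP : 1 ≤ P) (μ : Measure ℝ) {w g : ℝ → ℝ≥0∞}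
    (hw : Measurable w) (hg : Measurable g) :
    (∫⁻ s, w s * g s ∂μ) ^ P ≤ (∫⁻ s, w s ∂μ) ^ (P - 1) * ∫⁻ s, w s * g s ^ P ∂μ := by
  have hP0 : 0 < P := by linarith
  have h1 := eLpNorm'_le_eLpNorm'_mul_rpow_measure_univ (μ := μ.withDensity w) (f := g)
    one_pos hP hg.aestronglyMeasurable
  simp only [eLpNorm', enorm_eq_self, ENNReal.rpow_one, one_div, inv_one,
    withDensity_apply _ MeasurableSet.univ, Measure.restrict_univ] at h1
  rw [lintegral_withDensity_eq_lintegral_mul _ hw hg,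
    lintegral_withDensity_eq_lintegral_mul _ hw (hg.pow_const P)] at h1
  calc (∫⁻ s, w s * g s ∂μ) ^ P
      ≤ ((∫⁻ s, w s * g s ^ P ∂μ) ^ P⁻¹ * (∫⁻ s, w s ∂μ) ^ (1 - P⁻¹)) ^ P := by
        gcongr
        exact h1
    _ = _ := by
        rw [ENNReal.mul_rpow_of_nonneg _ _ hP0.le, ← ENNReal.rpow_mul, ← ENNReal.rpow_mul,
          inv_mul_cancel₀ hP0.ne', ENNReal.rpow_one, sub_mul, inv_mul_cancel₀ hP0.ne', one_mul,
          mul_comm]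

theorem lintegral_Ioi_Ioi_swap {F G : ℝ → ℝ≥0∞} (hF : Measurable F) (hG : Measurable G) :
    ∫⁻ t in Ioi (0 : ℝ), F t * ∫⁻ s in Ioi t, G s =
      ∫⁻ s in Ioi (0 : ℝ), G s * ∫⁻ t in Ioo 0 s, F t := by
  have hH : Measurable (Function.uncurry fun t s : ℝ => (Ioi t).indicator (fun s => F t * G s) s) :=
    ((hF.comp measurable_fst).mul (hG.comp measurable_snd)).indicator
      (measurableSet_lt measurable_fst measurable_snd)
  have h1 : ∀ t ∈ Ioi (0 : ℝ), F t * ∫⁻ s in Ioi t, G s =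
      ∫⁻ s in Ioi (0 : ℝ), (Ioi t).indicator (fun s => F t * G s) s := by
    intro t (ht : 0 < t)
    rw [setLIntegral_indicator measurableSet_Ioi, Ioi_inter_Ioi, max_eq_left ht.le,
      lintegral_const_mul _ hG]
  have h2 : ∀ s ∈ Ioi (0 : ℝ), ∫⁻ t in Ioi (0 : ℝ), (Ioi t).indicator (fun s => F t * G s) s =
      G s * ∫⁻ t in Ioo 0 s, F t := by
    intro s _
    have h3 : ∀ t : ℝ, (Ioi t).indicator (fun s => F t * G s) s =
        (Iio s).indicator (fun t => G s * F t) t := by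
      intro t
      simp only [indicator, mem_Ioi, mem_Iio, mul_comm]
    simp only [h3]
    rw [setLIntegral_indicator measurableSet_Iio, Iio_inter_Ioi, lintegral_const_mul _ hF]
  rw [setLIntegral_congr_fun measurableSet_Ioi h1, lintegral_lintegral_swap hH.aemeasurable,
    setLIntegral_congr_fun measurableSet_Ioi h2]

/-- Hardy's inequality for the tail integral. -/
theorem hardy_inequality {P a : ℝ} (hP : 1 ≤ P) (ha : 0 < a) {g : ℝ → ℝ≥0∞} (hg : Measurable g) :
    ∫⁻ t in Ioi (0 : ℝ), ENNReal.ofReal t⁻¹ *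
        (ENNReal.ofReal (t ^ a) * ∫⁻ s in Ioi t, ENNReal.ofReal (s ^ (-a - 1)) * g s) ^ P ≤
      ENNReal.ofReal (a ^ (-P)) * ∫⁻ s in Ioi (0 : ℝ), ENNReal.ofReal s⁻¹ * g s ^ P := by
  have hw : Measurable fun s : ℝ => ENNReal.ofReal (s ^ (-a - 1)) := by fun_prop
  have hF : Measurable fun s : ℝ => ENNReal.ofReal (s ^ (a - 1)) := by fun_prop
  have hP0 : 0 < P := by linarith
  have hP1 : 0 ≤ P - 1 := by linarith
  calc ∫⁻ t in Ioi (0 : ℝ), ENNReal.ofReal t⁻¹ *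
        (ENNReal.ofReal (t ^ a) * ∫⁻ s in Ioi t, ENNReal.ofReal (s ^ (-a - 1)) * g s) ^ P
      ≤ ∫⁻ t in Ioi (0 : ℝ), ENNReal.ofReal (a ^ (1 - P)) * (ENNReal.ofReal (t ^ (a - 1)) *
          ∫⁻ s in Ioi t, ENNReal.ofReal (s ^ (-a - 1)) * g s ^ P) := by
        refine setLIntegral_mono' measurableSet_Ioi fun t (ht : 0 < t) => ?_
        -- The weight `s ^ (-a - 1)` has mass `t ^ (-a) / a` on `(t, ∞)`, so all powers of `t`
        -- combine to `t ^ (a - 1)`. Exchanging the integrals then gives the inner integral `s ^ a /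
        -- a`.
        have h1 := rpow_lintegral_mul_le hP (volume.restrict (Ioi t)) hw hg
        rw [lintegral_Ioi_rpow_neg ha ht] at h1
        rw [ENNReal.mul_rpow_of_nonneg _ _ hP0.le]
        calc _ ≤ ENNReal.ofReal t⁻¹ * (ENNReal.ofReal (t ^ a) ^ P *
              (ENNReal.ofReal (t ^ (-a) / a) ^ (P - 1) *
                ∫⁻ s in Ioi t, ENNReal.ofReal (s ^ (-a - 1)) * g s ^ P)) := by gcongr
          _ = _ := by
            rw [ENNReal.ofReal_rpow_of_nonneg (by positivity) hP0.le,
              ENNReal.ofReal_rpow_of_nonneg (by positivity) hP1, ← mul_assoc, ← mul_assoc,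
              ← ENNReal.ofReal_mul (by positivity), ← ENNReal.ofReal_mul (by positivity),
              ← mul_assoc, ← ENNReal.ofReal_mul (by positivity)]
            congr 2
            rw [Real.div_rpow (by positivity) ha.le, ← Real.rpow_mul ht.le, ← Real.rpow_mul ht.le,
              show 1 - P = -(P - 1) by ring, Real.rpow_neg ha.le, div_eq_mul_inv, ← mul_assoc,
              mul_comm (a ^ (P - 1))⁻¹, mul_assoc t⁻¹, ← Real.rpow_add ht,
              Real.rpow_sub_one ht.ne', ← div_eq_inv_mul]
            congr 3
            ring
    _ = ENNReal.ofReal (a ^ (1 - P)) * ∫⁻ s in Ioi (0 : ℝ),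
          (ENNReal.ofReal (s ^ (-a - 1)) * g s ^ P) * ENNReal.ofReal (s ^ a / a) := by
        rw [lintegral_const_mul' _ _ ENNReal.ofReal_ne_top,
          lintegral_Ioi_Ioi_swap hF
            (G := fun s => ENNReal.ofReal (s ^ (-a - 1)) * g s ^ P) (hw.mul (hg.pow_const P))]
        congr 1
        refine setLIntegral_congr_fun measurableSet_Ioi fun s hs => ?_
        simp only [lintegral_Ioo_rpow ha hs]
    _ = ENNReal.ofReal (a ^ (1 - P)) * ∫⁻ s in Ioi (0 : ℝ),
          ENNReal.ofReal a⁻¹ * (ENNReal.ofReal s⁻¹ * g s ^ P) := by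
        congr 1
        refine setLIntegral_congr_fun measurableSet_Ioi fun s (hs : 0 < s) => ?_
        rw [mul_right_comm, ← mul_assoc, ← ENNReal.ofReal_mul (by positivity),
          ← ENNReal.ofReal_mul (by positivity)]
        congr 2
        rw [div_eq_mul_inv, ← mul_assoc, ← Real.rpow_add hs, show -a - 1 + a = -1 by ring,
          Real.rpow_neg_one, mul_comm]
    _ = _ := by
        rw [lintegral_const_mul' _ _ ENNReal.ofReal_ne_top, ← mul_assoc,
          ← ENNReal.ofReal_mul (by positivity), ← Real.rpow_neg_one, ← Real.rpow_add ha]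
        congr 3
        ring

/-- A function vanishing at infinity is bounded by the tail integral of a bound of its
derivative. -/
theorem enorm_le_lintegral_of_hasDerivAt {Z : Type*} [NormedAddCommGroup Z] [NormedSpace ℝ Z]
    [CompleteSpace Z] {f f' : ℝ → Z} {G : ℝ → ℝ≥0∞}
    (hder : ∀ s : ℝ, 0 < s → HasDerivAt f (f' s) s) (hlim : Tendsto f atTop (𝓝 0))
    (hG : ∀ s : ℝ, 0 < s → ‖f' s‖ₑ ≤ G s) {t : ℝ} (ht : 0 < t) :
    ‖f t‖ₑ ≤ ∫⁻ s in Ioi t, G s := by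
  have h1 : ∫⁻ s in Ioi t, ‖f' s‖ₑ ≤ ∫⁻ s in Ioi t, G s :=
    setLIntegral_mono' measurableSet_Ioi fun s hs => hG s (ht.trans hs)
  refine le_trans ?_ h1
  -- Unless the bound is trivial, `f'` is integrable and the fundamental theorem of calculus applies
  -- up to infinity.
  rcases eq_or_ne (∫⁻ s in Ioi t, ‖f' s‖ₑ) ∞ with h | h
  · rw [h]
    exact le_top
  have hm : AEStronglyMeasurable f' (volume.restrict (Ioi t)) := by
    refine (aestronglyMeasurable_deriv f _).congr ?_
    filter_upwards [ae_restrict_mem measurableSet_Ioi] with s hs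
    exact (hder s (ht.trans hs)).deriv
  have h2 := integral_Ioi_of_hasDerivAt_of_tendsto (hder t ht).continuousAt.continuousWithinAt
    (fun s hs => hder s (ht.trans hs)) ⟨hm, lt_top_iff_ne_top.2 h⟩ hlim
  rw [zero_sub] at h2
  rw [← enorm_neg, ← h2]
  exact enorm_integral_le_lintegral_enorm _

/-! ### Real interpolation norms -/

/-- Monotonicity provides measurability in `t`, which the infimum over decompositions does not give
directly. -/
theorem monotone_kFunctional {E : Type*} [AddCommGroup E] (N₀ N₁ : E → ℝ≥0∞) (u : E) :
    Monotone fun t => kFunctional N₀ N₁ t u := by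
  intro s t hst
  simp only [kFunctional]
  gcongr

/-- Substitute `t = s ^ 2`: then `t ^ (-1/2) = s⁻¹` and `dt/t = 2 ds/s`. Dropping the factor `2`
leaves an inequality. -/
theorem interpNorm_half_rpow {E : Type*} [AddCommGroup E] (N₀ N₁ : E → ℝ≥0∞) {p : ℝ≥0∞}
    (hp0 : p ≠ 0) (hp : p ≠ ∞) (u : E) :
    ∫⁻ s in Ioi (0 : ℝ), ENNReal.ofReal s⁻¹ *
        (ENNReal.ofReal s⁻¹ * kFunctional N₀ N₁ (s ^ 2) u) ^ p.toReal ≤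
      interpNorm N₀ N₁ (1 / 2) p u ^ p.toReal := by
  have hP := ENNReal.toReal_pos hp0 hp
  have hK : Measurable fun t => kFunctional N₀ N₁ t u := (monotone_kFunctional N₀ N₁ u).measurable
  have hm : Measurable fun t : ℝ => (ENNReal.ofReal (t ^ (-(1 / 2) : ℝ)) *
      kFunctional N₀ N₁ t u) ^ p.toReal := by
    have h1 : Measurable fun t : ℝ => ENNReal.ofReal (t ^ (-(1 / 2) : ℝ)) := by fun_prop
    exact (h1.mul hK).pow_const _
  have himage : (fun s : ℝ => s ^ 2) '' Ioi 0 = Ioi 0 := by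
    ext t
    constructor
    · rintro ⟨s, hs, rfl⟩
      exact pow_pos (mem_Ioi.1 hs) 2
    · exact fun ht => ⟨√t, Real.sqrt_pos.2 ht, Real.sq_sqrt (le_of_lt ht)⟩
  have hsubst := lintegral_image_eq_lintegral_abs_deriv_mul (s := Ioi (0 : ℝ))
    (f := fun s : ℝ => s ^ 2) (f' := fun s => 2 * s) measurableSet_Ioi
    (fun s _ => by simpa using (hasDerivAt_pow 2 s).hasDerivWithinAt)
    (fun s hs t ht hst => (pow_left_inj₀ (le_of_lt hs) (le_of_lt ht) two_ne_zero).1 hst)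
    (fun t : ℝ => ENNReal.ofReal t⁻¹ * (ENNReal.ofReal (t ^ (-(1 / 2) : ℝ)) *
      kFunctional N₀ N₁ t u) ^ p.toReal)
  rw [himage] at hsubst
  rw [interpNorm, eLpNorm_eq_lintegral_rpow_enorm_toReal hp0 hp, one_div p.toReal,
    ENNReal.rpow_inv_rpow hP.ne']
  simp only [enorm_eq_self]
  rw [lintegral_withDensity_eq_lintegral_mul _ (by fun_prop) hm]
  simp only [Pi.mul_apply]
  rw [hsubst]
  refine setLIntegral_mono' measurableSet_Ioi fun s (hs : 0 < s) => ?_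
  have h1 : (s ^ 2) ^ (-(1 / 2) : ℝ) = s⁻¹ := by
    rw [← Real.rpow_natCast, ← Real.rpow_mul hs.le]
    norm_num [Real.rpow_neg_one]
  rw [h1, ← mul_assoc, ← ENNReal.ofReal_mul (abs_nonneg _)]
  gcongr
  rw [abs_of_pos (by positivity), show 2 * s * (s ^ 2)⁻¹ = 2 * s⁻¹ by field_simp]
  have := inv_pos.2 hs
  linarith

theorem le_kFunctional_extrapEmb {A : X →ₗ.[ℂ] X} {x : X} {s : ℝ} (hs : 0 < s) {g : ℝ≥0∞}
    (hg : ∀ (y z u v : X) (hy : extrapEmb A y ∈ A.domain) (hv : v ∈ A.domain),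
      A ⟨extrapEmb A y, hy⟩ = u → A ⟨v, hv⟩ = extrapEmb A z → u + v = extrapEmb A x →
        g ≤ ‖y‖ₑ + ENNReal.ofReal s * ‖z‖ₑ) :
    g ≤ kFunctional (homNormNegOne A) (homNormOne A) s (extrapEmb A x) := by
  -- A zero factor would turn the value `∞` off the subspace into `0`, so it could not be moved
  -- inside the infimum.
  have hs0 : ENNReal.ofReal s ≠ 0 := by simpa using hs
  simp only [kFunctional, homNormNegOne, homNormOne, ENNReal.mul_iInf_of_ne hs0
    ENNReal.ofReal_ne_top, ENNReal.iInf_add, ENNReal.add_iInf, le_iInf_iff]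
  intro u v huv z hv hz y hy hu
  exact hg y z u v hy hv hu hz huv

/-! ### From decompositions in the extrapolation space to weighted bounds on orbits -/

section Embedding

variable [CompleteSpace X] {A : X →ₗ.[ℂ] X} {S D : ℝ → X →L[ℂ] X} {M K a : ℝ}

/-- The pointwise bound at `t/2` gives `2 ^ a`, and two derivatives at time `t/4` give `16 M ^ 2`.
The summand `1` in `c` keeps it positive, so that one can divide by it before taking the infimum
over decompositions. -/
theorem IsSmoothSemigroup.enorm_deriv_observeOp_le (h : IsSmoothSemigroup S D M)
    (hinj : Function.Injective (fun x : A.domain => A x))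
    (hR : ∀ x, shiftInv A 1 x = ∫ t in Ioi (0 : ℝ), Real.exp (-1 * t) • S t x)
    (hAR : IsShiftInverse A 1 (shiftInv A 1)) (B : X →L[ℂ] Z) (hK : 0 ≤ K)
    (hB : ∀ t : ℝ, 0 < t → ∀ x, ‖observeOp B S D t x‖ ≤ K * t ^ (-a) * ‖x‖)
    {c : ℝ} (hc : c = K * 2 ^ a * (16 * M ^ 2 + M) + 1) (x : X) {t : ℝ} (ht : 0 < t) :
    ‖observeOp B S D (t / 2) (D (t / 2) x)‖ₑ ≤ ENNReal.ofReal (t ^ (-a - 1)) *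
      (ENNReal.ofReal c * (ENNReal.ofReal t⁻¹ *
        kFunctional (homNormNegOne A) (homNormOne A) (t ^ 2) (extrapEmb A x))) := by
  have hM := h.bound_nonneg
  have hc0 : 0 < c := by rw [hc]; positivity
  have ht2 : 0 < t / 2 := by linarith
  have ht4 : 0 < t / 2 / 2 := by linarith
  set w := t ^ (-a - 1) * (c * t⁻¹) with hw
  have hw0 : 0 < w := by positivity
  have key : ENNReal.ofReal (w⁻¹ * ‖observeOp B S D (t / 2) (D (t / 2) x)‖) ≤
      kFunctional (homNormNegOne A) (homNormOne A) (t ^ 2) (extrapEmb A x) := by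
    refine le_kFunctional_extrapEmb (pow_pos ht 2) fun y z u v hy hv hu hz huv => ?_
    rw [← ofReal_norm, ← ofReal_norm, ← ENNReal.ofReal_mul (by positivity),
      ← ENNReal.ofReal_add (by positivity) (by positivity)]
    refine ENNReal.ofReal_le_ofReal ?_
    rw [inv_mul_le_iff₀ hw0]
    have hdec := h.deriv_decomposition hinj hR hAR hy hu hv hz huv ht2
    have hDx : ‖D (t / 2) x‖ ≤ M / (t / 2 / 2) * (M / (t / 2 / 2) * ‖y‖) + M * ‖z‖ := by
      rw [← norm_neg, hdec]
      refine (norm_add_le _ _).trans (add_le_add ?_ ?_)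
      · refine ((D _).le_of_opNorm_le (h.norm_deriv_le _ ht4) _).trans ?_
        gcongr
        exact (D _).le_of_opNorm_le (h.norm_deriv_le _ ht4) _
      · exact (S _).le_of_opNorm_le (h.norm_le _ ht2) _
    calc ‖observeOp B S D (t / 2) (D (t / 2) x)‖
        ≤ K * (t / 2) ^ (-a) * ‖D (t / 2) x‖ := hB _ ht2 _
      _ ≤ K * (t / 2) ^ (-a) *
          (M / (t / 2 / 2) * (M / (t / 2 / 2) * ‖y‖) + M * ‖z‖) := by gcongr
      _ = t ^ (-a - 1) * t⁻¹ * ((K * 2 ^ a * (16 * M ^ 2)) * ‖y‖ +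
          (K * 2 ^ a * M) * (t ^ 2 * ‖z‖)) := by
        rw [Real.div_rpow ht.le zero_le_two, Real.rpow_neg zero_le_two, div_inv_eq_mul,
          Real.rpow_sub_one ht.ne']
        field_simp
        ring
      _ ≤ t ^ (-a - 1) * t⁻¹ * (c * ‖y‖ + c * (t ^ 2 * ‖z‖)) := by
        have h1 : 0 ≤ K * 2 ^ a * (16 * M ^ 2) := by positivity
        have h2 : 0 ≤ K * 2 ^ a * M := by positivity
        gcongr <;> rw [hc] <;> linarith
      _ = w * (‖y‖ + t ^ 2 * ‖z‖) := by rw [hw]; ring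
  calc ‖observeOp B S D (t / 2) (D (t / 2) x)‖ₑ
      = ENNReal.ofReal w * ENNReal.ofReal (w⁻¹ * ‖observeOp B S D (t / 2) (D (t / 2) x)‖) := by
        rw [← ENNReal.ofReal_mul hw0.le, mul_inv_cancel_left₀ hw0.ne', ofReal_norm]
    _ ≤ ENNReal.ofReal w * _ := mul_le_mul_right key _
    _ = _ := by
        rw [hw, ENNReal.ofReal_mul (by positivity), ENNReal.ofReal_mul hc0.le, mul_assoc, mul_assoc]

/-- The orbit tends to `0` by the pointwise bound and is thus controlled by the tail integral of its
derivative. Hardy's inequality with `g s` a multiple of `s⁻¹ K(s²)` and the substitution in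
`interpNorm_half_rpow` finish the estimate. -/
theorem IsSmoothSemigroup.eLpNorm_observeOp_le_interpNorm [CompleteSpace Z]
    (h : IsSmoothSemigroup S D M)
    (hinj : Function.Injective (fun x : A.domain => A x))
    (hR : ∀ x, shiftInv A 1 x = ∫ t in Ioi (0 : ℝ), Real.exp (-1 * t) • S t x)
    (hAR : IsShiftInverse A 1 (shiftInv A 1)) (B : X →L[ℂ] Z) (hK : 0 ≤ K) (ha : 0 < a)
    (hB : ∀ t : ℝ, 0 < t → ∀ x, ‖observeOp B S D t x‖ ≤ K * t ^ (-a) * ‖x‖)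
    {p : ℝ≥0∞} (hp : 1 ≤ p) (hpt : p ≠ ∞) :
    ∃ c : ℝ≥0, ∀ x, eLpNorm (fun t : ℝ => t ^ (a - (p⁻¹).toReal) • observeOp B S D t x) p
      (volume.restrict (Ioi 0)) ≤
        c * interpNorm (homNormNegOne A) (homNormOne A) (1 / 2) p (extrapEmb A x) := by
  have hp0 : p ≠ 0 := (zero_lt_one.trans_le hp).ne'
  have hP0 := ENNReal.toReal_pos hp0 hpt
  have hP : 1 ≤ p.toReal := by
    rw [← ENNReal.toReal_one]
    exact ENNReal.toReal_mono hpt hp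
  set c := K * 2 ^ a * (16 * M ^ 2 + M) + 1 with hc
  refine ⟨(a⁻¹).toNNReal * c.toNNReal, fun x => ?_⟩
  set k := fun s => kFunctional (homNormNegOne A) (homNormOne A) s (extrapEmb A x) with hk
  have hkm : Measurable k := (monotone_kFunctional _ _ _).measurable
  set g : ℝ → ℝ≥0∞ := fun s => ENNReal.ofReal c * (ENNReal.ofReal s⁻¹ * k (s ^ 2)) with hg
  have hgm : Measurable g := by
    have h1 : Measurable fun s : ℝ => k (s ^ 2) := hkm.comp (measurable_id.pow_const 2)
    have h2 : Measurable fun s : ℝ => ENNReal.ofReal s⁻¹ := by fun_prop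
    exact (h2.mul h1).const_mul _
  have hlim : Tendsto (fun t => observeOp B S D t x) atTop (𝓝 0) := by
    apply squeeze_zero_norm' (a := fun t => K * t ^ (-a) * ‖x‖)
    · filter_upwards [eventually_gt_atTop 0] with t ht
      exact hB t ht x
    · simpa using ((tendsto_rpow_neg_atTop ha).const_mul K).mul_const ‖x‖
  rw [eLpNorm_rpow_smul hp0 hpt, one_div, ENNReal.rpow_inv_le_iff hP0]
  calc ∫⁻ t in Ioi (0 : ℝ), ENNReal.ofReal t⁻¹ *
        (ENNReal.ofReal (t ^ a) * ‖observeOp B S D t x‖ₑ) ^ p.toReal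
      ≤ ∫⁻ t in Ioi (0 : ℝ), ENNReal.ofReal t⁻¹ *
        (ENNReal.ofReal (t ^ a) * ∫⁻ s in Ioi t, ENNReal.ofReal (s ^ (-a - 1)) * g s) ^
          p.toReal := by
        refine setLIntegral_mono' measurableSet_Ioi fun t ht => ?_
        gcongr
        exact enorm_le_lintegral_of_hasDerivAt (fun s hs => h.hasDerivAt_observeOp B hs x) hlim
          (fun s hs => h.enorm_deriv_observeOp_le hinj hR hAR B hK hB hc x hs) ht
    _ ≤ ENNReal.ofReal (a ^ (-p.toReal)) *
        ∫⁻ s in Ioi (0 : ℝ), ENNReal.ofReal s⁻¹ * g s ^ p.toReal := hardy_inequality hP ha hgm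
    _ = ENNReal.ofReal (a ^ (-p.toReal)) * (ENNReal.ofReal c ^ p.toReal *
        ∫⁻ s in Ioi (0 : ℝ), ENNReal.ofReal s⁻¹ *
          (ENNReal.ofReal s⁻¹ * k (s ^ 2)) ^ p.toReal) := by
        rw [← lintegral_const_mul' _ _ (ENNReal.rpow_ne_top_of_nonneg hP0.le ENNReal.ofReal_ne_top)]
        congr 1
        refine lintegral_congr fun s => ?_
        rw [hg, ENNReal.mul_rpow_of_nonneg _ _ hP0.le, mul_left_comm]
    _ ≤ ENNReal.ofReal (a ^ (-p.toReal)) * (ENNReal.ofReal c ^ p.toReal *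
        interpNorm (homNormNegOne A) (homNormOne A) (1 / 2) p (extrapEmb A x) ^ p.toReal) := by
        gcongr
        exact interpNorm_half_rpow _ _ hp0 hpt _
    _ = _ := by
        rw [ENNReal.coe_mul, ENNReal.mul_rpow_of_nonneg _ _ hP0.le,
          ENNReal.mul_rpow_of_nonneg _ _ hP0.le, mul_assoc, Real.rpow_neg ha.le,
          ← Real.inv_rpow ha.le, ← ENNReal.ofReal_rpow_of_pos (inv_pos.2 ha)]
        rfl

end Embedding

/-- Continuity of the orbits on `(0, ∞)` makes the measurability in `MemLp` automatic, so only the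
norm bound remains. -/
theorem isBoundedObservation_iff {A : X →ₗ.[ℂ] X} {T : ℂ → X →L[ℂ] X} {C : A.domain →ₗ[ℂ] Z}
    {O : ℝ → X →L[ℂ] Z} (hO : ∀ x, ∀ t : ℝ, 0 < t → observation A T C x t = O t x)
    (hcont : ∀ x, ContinuousOn (fun t => O t x) (Ioi 0)) (p : ℝ≥0∞) (β : ℝ) :
    IsBoundedObservation A T C p β ↔ ∃ N : ℝ≥0, ∀ x,
      eLpNorm (fun t : ℝ => t ^ β • O t x) p (volume.restrict (Ioi 0)) ≤ N * ‖x‖ₑ := by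
  have hae : ∀ x, (fun t : ℝ => t ^ β • observation A T C x t) =ᵐ[volume.restrict (Ioi 0)]
      fun t : ℝ => t ^ β • O t x := by
    intro x
    filter_upwards [ae_restrict_mem measurableSet_Ioi] with t ht
    rw [hO x t ht]
  refine exists_congr fun N => forall_congr' fun x => ?_
  rw [memLp_congr_ae (hae x), eLpNorm_congr_ae (hae x)]
  refine ⟨fun h => h.2, fun h => ⟨⟨?_, h.trans_lt (ENNReal.mul_lt_top ENNReal.coe_lt_top
    enorm_lt_top)⟩, h⟩⟩
  have hc : ContinuousOn (fun t : ℝ => t ^ β) (Ioi 0) := fun t ht =>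
    (Real.continuousAt_rpow_const _ _ (Or.inl (ne_of_gt ht))).continuousWithinAt
  exact (hc.smul (hcont x)).aestronglyMeasurable measurableSet_Ioi

end SectorialOp

end

theorem theorem5p5 {X Z : Type*}
    [NormedAddCommGroup X] [NormedSpace ℂ X] [CompleteSpace X]
    [NormedAddCommGroup Z] [NormedSpace ℂ Z] [CompleteSpace Z]
    (p q : ℝ≥0∞) (hp : 1 ≤ p) (hpq : p ≤ q)
    (A : X →ₗ.[ℂ] X) (ω : ℝ) (hω₀ : 0 ≤ ω) (hω : ω < Real.pi / 2)
    (hA : SectorialOp.IsSectorial A ω) (hinj : Function.Injective (fun x : A.domain => A x))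
    (T : ℂ → X →L[ℂ] X) (hT : SectorialOp.IsBoundedAnalyticSemigroup T)
    (hAT : SectorialOp.NegGenerates A T)
    (C : A.domain →ₗ[ℂ] Z) (hC : ∃ K : ℝ, ∀ x : A.domain, ‖C x‖ ≤ K * ‖(x : X) + A x‖)
    (α : ℝ) (hα : α ∈ Set.Ioo (-(p⁻¹).toReal) (1 - (p⁻¹).toReal)) :
    (SectorialOp.IsBoundedObservation A T C p α →
      SectorialOp.IsBoundedObservation A T C q (α + (p⁻¹).toReal - (q⁻¹).toReal)) ∧
    (SectorialOp.IsBoundedObservation A T C q (α + (p⁻¹).toReal - (q⁻¹).toReal) →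
      SectorialOp.EmbedsInHomInterp A (1 / 2) p →
      SectorialOp.IsBoundedObservation A T C p α) := by
  obtain ⟨M, hS⟩ := hT.exists_isSmoothSemigroup
  obtain ⟨K, hCK⟩ := hC
  obtain ⟨R, hAR', hR'⟩ := hAT 1 one_pos
  rw [Complex.ofReal_one] at hAR'
  obtain rfl : SectorialOp.shiftInv A 1 = R := hAR'.shiftInv_eq
  have hO := fun x t ht => hS.observation_eq hR' hAR' C K hCK x (t := t) ht
  set B := SectorialOp.observeResolvent hAR' C K hCK
  have hcont := hS.continuousOn_observeOp B
  have hlap : ∀ l : ℝ, 0 < l → ∃ R : X →L[ℂ] X,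
      ∀ x, R x = ∫ t in Set.Ioi (0 : ℝ), Real.exp (-l * t) • T t x := fun l hl => by
    obtain ⟨R, -, hR⟩ := hAT l hl
    exact ⟨R, hR⟩
  rw [SectorialOp.isBoundedObservation_iff hO hcont, SectorialOp.isBoundedObservation_iff hO hcont]
  -- In terms of `a` the two weights are `a - 1/p` and `a - 1/q`.
  obtain ⟨a, rfl⟩ : ∃ a, α = a - (p⁻¹).toReal := ⟨α + (p⁻¹).toReal, by ring⟩
  have ha : 0 < a := by linarith [hα.1]
  rw [sub_add_cancel]
  constructor
  · rintro ⟨N, hN⟩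
    obtain ⟨c, hc, hbd⟩ := hS.exists_norm_observeOp_le B hp ha hN hlap
    refine ⟨max c.toNNReal N, fun x => ?_⟩
    refine SectorialOp.eLpNorm_rpow_smul_le_of_le hp hpq
      (ENNReal.mul_ne_top ENNReal.coe_ne_top enorm_ne_top) (fun t ht => ?_) ((hN x).trans ?_)
    · calc ENNReal.ofReal (t ^ a) * ‖SectorialOp.observeOp B (fun t : ℝ => T t) _ t x‖ₑ
          ≤ ENNReal.ofReal (t ^ a) * ENNReal.ofReal (c * t ^ (-a) * ‖x‖) := by
            rw [← ofReal_norm]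
            gcongr
            exact hbd t ht x
        _ = ENNReal.ofReal c * ‖x‖ₑ := by
            rw [← ofReal_norm, ← ENNReal.ofReal_mul (by positivity), ← ENNReal.ofReal_mul hc,
              Real.rpow_neg ht.le]
            congr 1
            field_simp
        _ ≤ _ := by
            gcongr
            exact ENNReal.coe_le_coe.2 (le_max_left _ _)
    · gcongr
      exact le_max_right _ _
  · rintro ⟨N, hN⟩ ⟨d, hd⟩
    -- For `p = ∞` also `q = ∞` and the two bounds coincide; the Hardy argument needs finite `p`.
    rcases eq_or_ne p ∞ with rfl | hpt
    · obtain rfl : q = ∞ := top_le_iff.1 hpq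
      exact ⟨N, hN⟩
    obtain ⟨c, hc, hbd⟩ := hS.exists_norm_observeOp_le B (hp.trans hpq) ha hN hlap
    obtain ⟨e, he⟩ := hS.eLpNorm_observeOp_le_interpNorm hinj hR' hAR' B hc ha hbd hp hpt
    refine ⟨e * d, fun x => (he x).trans ?_⟩
    rw [ENNReal.coe_mul, mul_assoc]
    gcongr
    exact hd x
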